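/- **Setting.** Let $\mathcal X\subset\mathbb R^d$ and let $(\rho_t)_{t\ge 0}$ be the transition kernels of a time-homogeneous Markov process on $\mathcal X$ (for instance, of the solution of an SDE $dX_t=b(X_t)\,dt+\sigma(X_t)\,dW_t$): every $\rho_t$ is a Markov kernel, $\rho_0(x,\cdot)=\delta_x$, and the Chapman–Kolmogorov equations hold. Let $\mu$ be a Borel probability measure on $\mathcal X$ that is invariant under all $\rho_t$ and ergodic: for all $t>0$, every measurable $A$ with $\rho_t(x,A)=1$ for all $x\in A$ satisfies $\mu(A)\in\{0,1\}$. Let $\mathbb H$ be the (real) reproducing kernel Hilbert space of a continuous symmetric positive semidefinite kernel $k:\mathcal X\times\mathcal X\to\mathbb R$, and let $\Phi(x)=k(x,\cdot)$ and $\varphi(x)=k(x,x)$. Assume that $\varphi\in L^2_\mu$, that $\psi=0$ is the only $\psi\in L^2_\mu$ with $\iint k(x,y)\psi(x)\psi(y)\,d\mu(x)\,d\mu(y)=0$, and that every $\psi\in\mathbb H$ which vanishes $\mu$-a.e. vanishes everywhere. Let $K^t$, $(K^t\psi)(x)=\int\psi(y)\,\rho_t(x,dy)$, be the Koopman operator on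 $L^2_\mu$, with adjoint $(K^t)^*$, let $Q$ be the orthogonal projection of $L^2_\mu$ onto the orthogonal complement $L^2_{\mu,0}=\mathbb 1^\perp$ of the constants, and let $K_0^t$ be the restriction of $K^t$ to $L^2_{\mu,0}$. Let $\mathcal E:L^2_\mu\to\mathbb H$, $\mathcal E\psi=\int\psi(x)\Phi(x)\,d\mu(x)$, whose adjoint is the inclusion $\mathbb H\hookrightarrow L^2_\mu$, and let $C_{\mathbb H}^t=\mathcal E K^t\mathcal E^*$, i.e. $C_{\mathbb H}^t\psi=\int (K^t\psi)(x)\Phi(x)\,d\mu(x)$. Let $(e_i)$ be an orthonormal basis of $L^2_\mu$ of eigenfunctions of $\mathcal E^*\mathcal E$ with eigenvalues $\lambda_i>0$, and let $f_i=\sqrt{\lambda_i}\,e_i\in\mathbb H$ (a Mercer basis). Fix $t>0$ and set $$g_{ij}=f_j\cdot K^tf_i,\qquad g_{ji}^*=f_i\cdot (K^t)^*f_j,\qquad \mathbb E_0(t)=\langle K^t\varphi,\varphi\rangle_\mu-\|C_{\mathbb H}^t\|_{HS}^2,$$ $$F_m(T)=2\sum_{k=1}^{m-1}\tfrac{m-k}{m}\,T^{k-1},\qquad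 \sigma_m^2=\mathbb E_0(t)+\sum_{i,j}\langle Qg_{ji}^*,F_m(K_0^t)Qg_{ij}\rangle_\mu .$$ **Statement.** Assume that $1$ belongs to the resolvent set of $K_0^t$. Then $C_{\mathbb H}^t$ is a Hilbert–Schmidt operator, all $g_{ij}$ and $g_{ji}^*$ belong to $L^2_\mu$, and for every $m\ge 1$ the series defining $\sigma_m^2$ converges absolutely and $$\sigma_m^2\;\le\;\mathbb E_0(t)\,\bigl[1+\|F_m(K_0^t)\|\bigr]\;\le\;8\,\mathbb E_0(t)\,\bigl\|(I-K_0^t)^{-2}\bigr\| .$$ Moreover, the asymptotic variance $\sigma_\infty^2=\mathbb E_0(t)+2\sum_{i,j}\langle Qg_{ji}^*,(I-K_0^t)^{-1}Qg_{ij}\rangle_\mu$ (again an absolutely convergent series) satisfies $\sigma_\infty^2\le 8\,\mathbb E_0(t)\,\|(I-K_0^t)^{-2}\|$. -/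

import Mathlib

open MeasureTheory ProbabilityTheory
open scoped ENNReal NNReal InnerProductSpace

namespace KoopmanRKHS

noncomputable section

/-! ### Markov semigroups and ergodic invariant measures -/

section Markov

variable {α : Type*} [MeasurableSpace α]

/-- The family of transition kernels `ρ t x A = P(X_t ∈ A | X_0 = x)` of a time-homogeneous
Markov process in continuous time: `ρ 0 x = δ_x` and the Chapman-Kolmogorov equations. -/
structure IsTransitionSemigroup (ρ : ℝ≥0 → Kernel α α) : Prop where
  zero : ρ 0 = Kernel.id
  add : ∀ s t, ρ (s + t) = ρ t ∘ₖ ρ s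

/-- `μ` is ergodic: for `t > 0`, every `ρ t`-invariant measurable set has measure `0` or `1`. -/
def IsErgodic (ρ : ℝ≥0 → Kernel α α) (μ : Measure α) : Prop :=
  ∀ t, 0 < t → ∀ A : Set α, MeasurableSet A → (∀ x ∈ A, ρ t x A = 1) → μ A = 0 ∨ μ A = 1

end Markov

/-! ### The Koopman operator on `L²(μ)` -/

section Koopman

variable {α : Type*} [MeasurableSpace α] {μ : Measure α}

/-- `(K ψ)(x) = ∫ ψ(y) κ(x, dy)`. -/
def koopmanFun (κ : Kernel α α) (ψ : α → ℝ) : α → ℝ := fun x => ∫ y, ψ y ∂(κ x)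

theorem koopmanFun_congr {κ : Kernel α α} (hκ : κ.Invariant μ) {ψ ψ' : α → ℝ} (h : ψ =ᵐ[μ] ψ') :
    koopmanFun κ ψ =ᵐ[μ] koopmanFun κ ψ' := by
  have h' : ∀ᵐ y ∂(μ.bind κ), ψ y = ψ' y := by rw [hκ.def]; exact h
  filter_upwards [Measure.ae_ae_of_ae_comp h'] with x hx
  exact integral_congr_ae hx

theorem ae_integrable_kernel [IsFiniteMeasure μ] {κ : Kernel α α} (hκ : κ.Invariant μ)
    {ψ : α → ℝ} (hψ : MemLp ψ 2 μ) : ∀ᵐ x ∂μ, Integrable ψ (κ x) := by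
  refine Measure.ae_integrable_of_integrable_comp (μ := μ) (κ := κ) ?_
  rw [hκ.def]
  exact hψ.integrable (by norm_num)

variable {κ : Kernel α α} [IsMarkovKernel κ]

theorem eLpNorm_koopmanFun_le (hκ : κ.Invariant μ) {ψ : α → ℝ} (hψ : StronglyMeasurable ψ) :
    eLpNorm (koopmanFun κ ψ) 2 μ ≤ eLpNorm ψ 2 μ := by
  rw [eLpNorm_eq_lintegral_rpow_enorm_toReal (by norm_num) (by norm_num),
    eLpNorm_eq_lintegral_rpow_enorm_toReal (by norm_num) (by norm_num)]
  gcongr ?_ ^ _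
  have hm : Measurable fun y => ‖ψ y‖ₑ ^ (2 : ℝ≥0∞).toReal := hψ.enorm.pow_const _
  calc ∫⁻ x, ‖koopmanFun κ ψ x‖ₑ ^ (2 : ℝ≥0∞).toReal ∂μ
      ≤ ∫⁻ x, ∫⁻ y, ‖ψ y‖ₑ ^ (2 : ℝ≥0∞).toReal ∂(κ x) ∂μ := by
        refine lintegral_mono fun x => ?_
        have h1 : ‖koopmanFun κ ψ x‖ₑ ≤ eLpNorm ψ 1 (κ x) := by
          rw [eLpNorm_one_eq_lintegral_enorm]
          exact enorm_integral_le_lintegral_enorm _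
        have h2 : eLpNorm ψ 1 (κ x) ≤ eLpNorm ψ 2 (κ x) :=
          eLpNorm_le_eLpNorm_of_exponent_le (by norm_num) hψ.aestronglyMeasurable
        have h3 := h1.trans h2
        rw [eLpNorm_eq_lintegral_rpow_enorm_toReal (by norm_num) (by norm_num)] at h3
        calc _ ≤ _ := ENNReal.rpow_le_rpow h3 (by norm_num)
          _ = _ := by rw [← ENNReal.rpow_mul]; norm_num
    _ = ∫⁻ y, ‖ψ y‖ₑ ^ (2 : ℝ≥0∞).toReal ∂(μ.bind κ) :=
        (Measure.lintegral_bind κ.aemeasurable hm.aemeasurable).symm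
    _ = _ := by rw [hκ.def]

theorem memLp_koopmanFun (hκ : κ.Invariant μ) {ψ : α → ℝ} (hψ : MemLp ψ 2 μ) :
    MemLp (koopmanFun κ ψ) 2 μ := by
  have hs := hψ.1.stronglyMeasurable_mk
  refine MemLp.ae_eq (koopmanFun_congr hκ hψ.1.ae_eq_mk).symm ⟨?_, ?_⟩
  · exact (StronglyMeasurable.integral_kernel hs).aestronglyMeasurable
  · refine (eLpNorm_koopmanFun_le hκ hs).trans_lt ?_
    rw [← eLpNorm_congr_ae hψ.1.ae_eq_mk]
    exact hψ.2

/-- The Koopman operator `K` on `L²(μ)`, `(K ψ)(x) = ∫ ψ(y) κ(x, dy)`. For almost every `x` the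
integral exists and does not depend on the representative of `ψ`, by invariance of `μ`. -/
def koopman [IsFiniteMeasure μ] (κ : Kernel α α) [IsMarkovKernel κ] (hκ : κ.Invariant μ) :
    Lp ℝ 2 μ →L[ℝ] Lp ℝ 2 μ :=
  LinearMap.mkContinuous
    { toFun := fun ψ => (memLp_koopmanFun hκ (Lp.memLp ψ)).toLp _
      map_add' := fun ψ η => by
        rw [← MemLp.toLp_add]
        refine MemLp.toLp_congr _ _ ((koopmanFun_congr hκ (Lp.coeFn_add ψ η)).trans ?_)
        filter_upwards [ae_integrable_kernel hκ (Lp.memLp ψ), ae_integrable_kernel hκ (Lp.memLp η)]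
          with x h1 h2
        exact integral_add h1 h2
      map_smul' := fun c ψ => by
        rw [RingHom.id_apply, ← MemLp.toLp_const_smul]
        refine MemLp.toLp_congr _ _ ((koopmanFun_congr hκ (Lp.coeFn_smul c ψ)).trans ?_)
        exact Filter.Eventually.of_forall fun x => integral_const_mul c _ }
    1 fun ψ => by
      rw [one_mul]
      change ‖(memLp_koopmanFun hκ (Lp.memLp ψ)).toLp _‖ ≤ _
      rw [Lp.norm_toLp, Lp.norm_def]
      exact ENNReal.toReal_mono (Lp.memLp ψ).2.ne
        (eLpNorm_koopmanFun_le hκ (Lp.stronglyMeasurable ψ))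

theorem coeFn_koopman [IsFiniteMeasure μ] (hκ : κ.Invariant μ) (ψ : Lp ℝ 2 μ) :
    koopman κ hκ ψ =ᵐ[μ] koopmanFun κ ψ :=
  MemLp.coeFn_toLp (memLp_koopmanFun hκ (Lp.memLp ψ))

/-- `L²₀(μ) = 𝟙ᗮ`, the orthogonal complement of the constant functions in `L²(μ)`. -/
def L20 (μ : Measure α) [IsFiniteMeasure μ] : Submodule ℝ (Lp ℝ 2 μ) :=
  (ℝ ∙ Lp.const 2 μ (1 : ℝ))ᗮ

theorem mem_L20_iff [IsFiniteMeasure μ] (ψ : Lp ℝ 2 μ) : ψ ∈ L20 μ ↔ ∫ x, ψ x ∂μ = 0 := by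
  rw [L20, Submodule.mem_orthogonal_singleton_iff_inner_right, L2.inner_def]
  have : ∫ x, ⟪(Lp.const 2 μ (1 : ℝ)) x, ψ x⟫_ℝ ∂μ = ∫ x, ψ x ∂μ := by
    refine integral_congr_ae ?_
    filter_upwards [Lp.coeFn_const (p := 2) (μ := μ) (c := (1 : ℝ))] with x hx
    rw [hx]
    simp
  rw [this]

theorem koopman_mem_L20 [IsFiniteMeasure μ] (hκ : κ.Invariant μ) {ψ : Lp ℝ 2 μ}
    (hψ : ψ ∈ L20 μ) : koopman κ hκ ψ ∈ L20 μ := by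
  rw [mem_L20_iff] at hψ ⊢
  have hi : Integrable ψ (μ.bind κ) := by
    rw [hκ.def]; exact (Lp.memLp ψ).integrable (by norm_num)
  rw [integral_congr_ae (coeFn_koopman hκ ψ), ← hψ]
  rw [Measure.comp_eq_comp_const_apply] at hi
  have h := Kernel.integral_comp hi
  rw [← Measure.comp_eq_comp_const_apply, hκ.def, Kernel.const_apply] at h
  exact h.symm

/-- `K₀`, the restriction of the Koopman operator to `L²₀(μ)`. -/
def koopman0 [IsFiniteMeasure μ] (κ : Kernel α α) [IsMarkovKernel κ] (hκ : κ.Invariant μ) :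
    L20 μ →L[ℝ] L20 μ :=
  ((koopman κ hκ).comp (L20 μ).subtypeL).codRestrict (L20 μ)
    fun ψ => koopman_mem_L20 hκ ψ.2

/-- `Q`, the orthogonal projection of `L²(μ)` onto `L²₀(μ)`. -/
def projQ (μ : Measure α) [IsFiniteMeasure μ] : Lp ℝ 2 μ →L[ℝ] L20 μ :=
  haveI : (L20 μ).HasOrthogonalProjection := by unfold L20; infer_instance
  (L20 μ).orthogonalProjectionOnto

/-- The class in `L²(μ)` of a square-integrable function (`0` for other functions). -/
def classL2 (μ : Measure α) (g : α → ℝ) : Lp ℝ 2 μ :=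
  open Classical in if h : MemLp g 2 μ then h.toLp g else 0

end Koopman

/-! ### The reproducing kernel Hilbert space -/

section Kernel

variable {α : Type*} (H : Type*) [NormedAddCommGroup H] [InnerProductSpace ℝ H]
  [CompleteSpace H] [RKHS ℝ H α ℝ]

/-- The reproducing kernel `k(x, y)` of `H`. -/
def kern (x y : α) : ℝ := RKHS.kernel H x y 1

/-- The feature map `Φ(x) = k(x, ·)`. -/
def feature (x : α) : H := RKHS.kerFun H x (1 : ℝ)

/-- The kernel diagonal `φ(x) = k(x, x)`. -/
def diag (x : α) : ℝ := kern H x x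

theorem inner_feature (ψ : H) (x : α) : ⟪ψ, feature H x⟫_ℝ = ψ x := by
  simp [feature]

theorem inner_feature_feature (x y : α) : ⟪feature H x, feature H y⟫_ℝ = kern H x y := by
  rw [real_inner_comm, inner_feature, feature, kern, RKHS.kerFun_apply]

variable [TopologicalSpace α]

theorem continuous_feature (hk : Continuous fun p : α × α => kern H p.1 p.2) :
    Continuous (feature H : α → H) := by
  rw [continuous_iff_continuousAt]
  intro x
  rw [ContinuousAt, tendsto_iff_norm_sub_tendsto_zero]
  have h : Continuous fun y => kern H y y - 2 * kern H y x + kern H x x := by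
    have h1 : Continuous fun y => kern H y y :=
      Continuous.comp (f := fun y : α => (y, y)) hk (by fun_prop)
    have h2 : Continuous fun y => kern H y x :=
      Continuous.comp (f := fun y : α => (y, x)) hk (by fun_prop)
    fun_prop
  have h' := (Real.continuous_sqrt.comp h).tendsto x
  have e : ∀ y, ‖feature H y - feature H x‖ = √(kern H y y - 2 * kern H y x + kern H x x) := by
    intro y
    rw [← Real.sqrt_sq (norm_nonneg (feature H y - feature H x)), norm_sub_sq_real,
      ← real_inner_self_eq_norm_sq, ← real_inner_self_eq_norm_sq]
    simp only [inner_feature_feature]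
  simp only [Function.comp_apply] at h'
  simp only [e]
  convert! h' using 2
  rw [eq_comm, Real.sqrt_eq_zero']
  linarith

variable [MeasurableSpace α]

/-- The standing assumptions: the kernel is continuous, its diagonal is in `L²(μ)`, the energy
form of the kernel is definite on `L²(μ)`, and elements of `H` that vanish `μ`-a.e. vanish. -/
structure Compatible (μ : Measure α) : Prop where
  continuous : Continuous fun p : α × α => kern H p.1 p.2
  memLp_diag : MemLp (diag H) 2 μ
  eq_zero_of_energy : ∀ ψ : Lp ℝ 2 μ,
    ∫ x, ∫ y, kern H x y * ψ x * ψ y ∂μ ∂μ = 0 → ψ = 0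
  eq_zero_of_ae : ∀ ψ : H, (∀ᵐ x ∂μ, ψ x = 0) → ∀ x, ψ x = 0

variable {H} {μ : Measure α} [IsFiniteMeasure μ]

variable [SecondCountableTopology α] [OpensMeasurableSpace α]

theorem Compatible.memLp_feature (h : Compatible H μ) : MemLp (feature H) 2 μ := by
  have hm : AEStronglyMeasurable (feature H) μ :=
    (continuous_feature H h.continuous).aestronglyMeasurable
  rw [memLp_two_iff_integrable_sq_norm hm]
  have : (fun x => ‖feature H x‖ ^ 2) = diag H := by
    ext x
    rw [← real_inner_self_eq_norm_sq, inner_feature_feature, diag]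
  rw [this]
  exact h.memLp_diag.integrable (by norm_num)

theorem Compatible.memLp_coe (h : Compatible H μ) (ψ : H) : MemLp (ψ : α → ℝ) 2 μ := by
  have e : (ψ : α → ℝ) = fun x => ⟪ψ, feature H x⟫_ℝ := by
    ext x; exact (inner_feature H ψ x).symm
  rw [e]
  exact h.memLp_feature.const_inner ψ

/-- The inclusion `ψ ↦ ψ` of `H` into `L²(μ)`. -/
def incl (h : Compatible H μ) : H →L[ℝ] Lp ℝ 2 μ :=
  LinearMap.mkContinuous
    { toFun := fun ψ => (h.memLp_coe ψ).toLp _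
      map_add' := fun ψ η => by
        rw [← MemLp.toLp_add]
        exact MemLp.toLp_congr _ _ (by rw [RKHS.coe_add])
      map_smul' := fun c ψ => by
        rw [RingHom.id_apply, ← MemLp.toLp_const_smul]
        exact MemLp.toLp_congr _ _ (by rw [RKHS.coe_smul]) }
    (eLpNorm (feature H) 2 μ).toReal fun ψ => by
      change ‖(h.memLp_coe ψ).toLp _‖ ≤ _
      rw [Lp.norm_toLp, mul_comm, ← toReal_enorm ψ, ← ENNReal.toReal_mul]
      refine ENNReal.toReal_mono (ENNReal.mul_ne_top enorm_ne_top h.memLp_feature.2.ne) ?_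
      refine (eLpNorm_le_nnreal_smul_eLpNorm_of_ae_le_mul (c := ‖ψ‖₊) (g := feature H)
        (Filter.Eventually.of_forall fun x => ?_) 2).trans_eq ?_
      · rw [← inner_feature H ψ x]
        exact nnnorm_inner_le_nnnorm ψ _
      · rw [ENNReal.smul_def, smul_eq_mul]; rfl

/-- The integral operator `E ψ = ∫ ψ(x) Φ(x) dμ(x)` (a Bochner integral in `H`). -/
def integralOp (h : Compatible H μ) : Lp ℝ 2 μ →L[ℝ] H :=
  have hint : ∀ ψ : Lp ℝ 2 μ, Integrable (fun x => ψ x • feature H x) μ := fun ψ =>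
    memLp_one_iff_integrable.1 (h.memLp_feature.smul (Lp.memLp ψ))
  LinearMap.mkContinuous
    { toFun := fun ψ => ∫ x, ψ x • feature H x ∂μ
      map_add' := fun ψ η => by
        rw [← integral_add (hint ψ) (hint η)]
        refine integral_congr_ae ?_
        filter_upwards [Lp.coeFn_add ψ η] with x hx
        rw [hx, Pi.add_apply, add_smul]
      map_smul' := fun c ψ => by
        rw [RingHom.id_apply, ← integral_smul]
        refine integral_congr_ae ?_
        filter_upwards [Lp.coeFn_smul c ψ] with x hx
        rw [hx, Pi.smul_apply, smul_assoc] }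
    (eLpNorm (feature H) 2 μ).toReal fun ψ => by
      change ‖∫ x, ψ x • feature H x ∂μ‖ ≤ _
      rw [mul_comm, Lp.norm_def, ← toReal_enorm, ← ENNReal.toReal_mul]
      refine ENNReal.toReal_mono (ENNReal.mul_ne_top (Lp.memLp ψ).2.ne h.memLp_feature.2.ne) ?_
      refine (enorm_integral_le_lintegral_enorm _).trans ?_
      rw [← eLpNorm_one_eq_lintegral_enorm]
      exact eLpNorm_smul_le_mul_eLpNorm h.memLp_feature.1 (Lp.memLp ψ).1

theorem integralOp_apply (h : Compatible H μ) (ψ : Lp ℝ 2 μ) :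
    integralOp h ψ = ∫ x, ψ x • feature H x ∂μ := rfl

/-- The adjoint of `E` is the inclusion. -/
theorem adjoint_integralOp (h : Compatible H μ) :
    ContinuousLinearMap.adjoint (integralOp h) = incl h := by
  refine (ContinuousLinearMap.eq_adjoint_iff _ _).2 (fun η ψ => ?_) |>.symm
  have hint : Integrable (fun x => ψ x • feature H x) μ :=
    memLp_one_iff_integrable.1 (h.memLp_feature.smul (Lp.memLp ψ))
  rw [integralOp_apply, ← integral_inner hint, L2.inner_def]
  refine integral_congr_ae ?_
  filter_upwards [MemLp.coeFn_toLp (h.memLp_coe η)] with x hx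
  change ⟪((h.memLp_coe η).toLp _ : α → ℝ) x, ψ x⟫_ℝ = _
  rw [hx, inner_smul_right, inner_feature]
  simp

/-- The cross-covariance operator `C ψ = ∫ (K ψ)(x) Φ(x) dμ(x)`, i.e. `C = E K E*`. -/
def crossCov (h : Compatible H μ) (κ : Kernel α α) [IsMarkovKernel κ] (hκ : κ.Invariant μ) :
    H →L[ℝ] H :=
  (integralOp h).comp ((koopman κ hκ).comp (incl h))

/-- A Mercer basis: an orthonormal basis `e` of `L²(μ)` of eigenfunctions of `E* E` with
eigenvalues `lam i > 0`, together with the functions `f i = √(lam i) e i` as elements of `H`. -/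
structure MercerBasis (h : Compatible H μ) (ι : Type*) where
  e : HilbertBasis ι ℝ (Lp ℝ 2 μ)
  lam : ι → ℝ
  lam_pos : ∀ i, 0 < lam i
  eigen : ∀ i, ContinuousLinearMap.adjoint (integralOp h) (integralOp h (e i)) = lam i • e i
  f : ι → H
  f_eq : ∀ i, incl h (f i) = √(lam i) • e i

end Kernel

/-! ### Hilbert-Schmidt norm -/

section HilbertSchmidt

variable {H : Type*} [NormedAddCommGroup H] [InnerProductSpace ℝ H] [CompleteSpace H]

variable (H) in
/-- Some orthonormal basis of `H`. -/
def someBasis : HilbertBasis (exists_hilbertBasis ℝ H).choose ℝ H :=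
  (exists_hilbertBasis ℝ H).choose_spec.choose

/-- `T` is Hilbert-Schmidt: `∑ ‖T b_i‖² < ∞` for some (hence each) orthonormal basis. -/
def IsHilbertSchmidt (T : H →L[ℝ] H) : Prop := Summable fun i => ‖T (someBasis H i)‖ ^ 2

/-- `‖T‖²_HS = ∑ ‖T b_i‖²` for some (hence each) orthonormal basis. -/
def hsNormSq (T : H →L[ℝ] H) : ℝ := ∑' i, ‖T (someBasis H i)‖ ^ 2

end HilbertSchmidt

/-! ### The variance of the sliding-window estimator -/

section Variance

/-- `F_m(T) = 2 ∑_{k=1}^{m-1} ((m-k)/m) T^(k-1)`. -/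
def FOp {A : Type*} [Ring A] [Algebra ℝ A] (m : ℕ) (T : A) : A :=
  (2 : ℝ) • ∑ k ∈ Finset.Icc 1 (m - 1), (((m : ℝ) - k) / m) • T ^ (k - 1)

variable {α : Type*} [TopologicalSpace α] [SecondCountableTopology α] [MeasurableSpace α]
  [OpensMeasurableSpace α] {H : Type*} [NormedAddCommGroup H] [InnerProductSpace ℝ H]
  [CompleteSpace H] [RKHS ℝ H α ℝ] {μ : Measure α} [IsFiniteMeasure μ]

/-- `E₀ = ⟨K φ, φ⟩_μ - ‖C‖²_HS`. -/
def E0 (h : Compatible H μ) (κ : Kernel α α) [IsMarkovKernel κ] (hκ : κ.Invariant μ) : ℝ :=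
  ⟪koopman κ hκ (h.memLp_diag.toLp _), h.memLp_diag.toLp _⟫_ℝ - hsNormSq (crossCov h κ hκ)

variable {h : Compatible H μ} {ι : Type*}

/-- `g_ij = f_j · K f_i`. -/
def g (B : MercerBasis h ι) (κ : Kernel α α) [IsMarkovKernel κ] (hκ : κ.Invariant μ)
    (i j : ι) : α → ℝ :=
  fun x => B.f j x * koopman κ hκ (incl h (B.f i)) x

/-- `g*_ji = f_i · K* f_j`. -/
def gStar (B : MercerBasis h ι) (κ : Kernel α α) [IsMarkovKernel κ] (hκ : κ.Invariant μ)
    (j i : ι) : α → ℝ :=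
  fun x => B.f i x * ContinuousLinearMap.adjoint (koopman κ hκ) (incl h (B.f j)) x

/-- `⟨Q g*_ji, S Q g_ij⟩_μ` for an operator `S` on `L²₀(μ)`. -/
def crossTerm (B : MercerBasis h ι) (κ : Kernel α α) [IsMarkovKernel κ] (hκ : κ.Invariant μ)
    (S : L20 μ →L[ℝ] L20 μ) (i j : ι) : ℝ :=
  ⟪projQ μ (classL2 μ (gStar B κ hκ j i)), S (projQ μ (classL2 μ (g B κ hκ i j)))⟫_ℝ

/-- `σ_m² = E₀ + ∑_{i,j} ⟨Q g*_ji, F_m(K₀) Q g_ij⟩_μ`. -/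
def sigmaSq (B : MercerBasis h ι) (κ : Kernel α α) [IsMarkovKernel κ] (hκ : κ.Invariant μ)
    (m : ℕ) : ℝ :=
  E0 h κ hκ + ∑' p : ι × ι, crossTerm B κ hκ (FOp m (koopman0 κ hκ)) p.1 p.2

/-- The asymptotic variance `σ_∞² = E₀ + 2 ∑_{i,j} ⟨Q g*_ji, (I - K₀)⁻¹ Q g_ij⟩_μ`. -/
def sigmaInfSq (B : MercerBasis h ι) (κ : Kernel α α) [IsMarkovKernel κ] (hκ : κ.Invariant μ) :
    ℝ :=
  E0 h κ hκ + 2 * ∑' p : ι × ι, crossTerm B κ hκ (Ring.inverse (1 - koopman0 κ hκ)) p.1 p.2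

end Variance

end

end KoopmanRKHS

/-! The proof reduces to one estimate: for every bounded `S` on `L20 μ`, the cross terms of `S` sum
to at most `E0 * ‖S‖` (`tsum_crossTerm_le`). By Cauchy–Schwarz this follows once `∑ ‖Q g_ij‖²` and
`∑ ‖Q g*_ji‖²` are each at most `E0`. By Pythagoras `‖Q g_ij‖² = ‖g_ij‖² - ⟨1, g_ij⟩²`. The means
are `⟨1, g_ij⟩ = ⟨f_j, C f_i⟩_H`, and `f` is an orthonormal basis of `H`, so their squares sum to
`‖C‖²_HS`. Jensen's inequality `(K f_i)² ≤ K (f_i²)` and Mercer's identity `∑ f_i² = φ` give `∑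
‖g_ij‖² ≤ ⟨φ, K φ⟩` (`sum_norm_mulMarkov_sq_le`). Only positivity and `K 1 = 1` are used here, and
invariance of `μ` passes both to `K*`, which handles `g*`.

The rest is algebra for a contraction `T`: `(1 - T)²` times the weighted sum in `F_m(T)` telescopes,
so `‖F_m(T)‖ ≤ 4 ‖(1 - T)⁻²‖`, while `1 ≤ 4 ‖(1 - T)⁻²‖` accounts for the remaining `E0`. The latter
fails when `L20 μ` is trivial; there `E0 = 0`. -/

namespace KoopmanRKHS

/-! ### Norm bounds for `F_m` of a contraction -/

section FOp

/-- From `n` to `n + 1` the weighted sum grows by the geometric sum `∑_{j ≤ n} T^j`, and one factor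
`1 - T` collapses that sum to `1 - T^(n+1)`. -/
theorem one_sub_sq_mul_sum {A : Type*} [Ring A] [Algebra ℝ A] (T : A) (n : ℕ) :
    (1 - T) ^ 2 * ∑ j ∈ Finset.range n, ((n : ℝ) - j) • T ^ j =
      (n : ℝ) • (1 : A) - ((n : ℝ) + 1) • T + T ^ (n + 1) := by
  induction n with
  | zero => simp
  | succ n ih =>
    have e : ∑ j ∈ Finset.range (n + 1), (((n + 1 : ℕ) : ℝ) - j) • T ^ j =
        (∑ j ∈ Finset.range n, ((n : ℝ) - j) • T ^ j) + ∑ j ∈ Finset.range (n + 1), T ^ j := by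
      rw [Finset.sum_range_succ, Finset.sum_range_succ (fun j => T ^ j), ← add_assoc,
        ← Finset.sum_add_distrib]
      congr 1
      · refine Finset.sum_congr rfl fun j _ => ?_
        push_cast
        module
      · push_cast
        rw [add_sub_cancel_left, one_smul]
    rw [e, mul_add, ih, sq, mul_assoc (1 - T) (1 - T) (∑ j ∈ Finset.range (n + 1), T ^ j),
      mul_neg_geom_sum, sub_mul, one_mul, mul_sub, mul_one, ← pow_succ']
    push_cast
    module

theorem FOp_succ {A : Type*} [Ring A] [Algebra ℝ A] (T : A) (n : ℕ) :
    FOp (n + 1) T =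
      (2 / ((n : ℝ) + 1)) • ∑ j ∈ Finset.range n, ((n : ℝ) - j) • T ^ j := by
  have hI : Finset.Icc 1 (n + 1 - 1) = Finset.Ico 1 (n + 1) := by
    ext
    simp only [Finset.mem_Icc, Finset.mem_Ico]
    omega
  rw [FOp, hI, Finset.sum_Ico_eq_sum_range, Nat.add_sub_cancel, Finset.smul_sum, Finset.smul_sum]
  refine Finset.sum_congr rfl fun j _ => ?_
  rw [smul_smul, smul_smul, Nat.add_sub_cancel_left]
  congr 1
  push_cast
  ring

/-- The hypothesis `‖1‖ ≤ 1` replaces `NormOneClass` so that operators on a trivial space, where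
`‖1‖ = 0`, are covered. -/
theorem norm_one_sub_le {A : Type*} [NormedRing A] {T : A} (h1 : ‖(1 : A)‖ ≤ 1) (hT : ‖T‖ ≤ 1) : ‖1 - T‖ ≤ 2 :=
  (norm_sub_le _ _).trans (by linarith)

theorem norm_pow_succ_le_one {A : Type*} [NormedRing A] {T : A} (hT : ‖T‖ ≤ 1) (n : ℕ) : ‖T ^ (n + 1)‖ ≤ 1 :=
  (norm_pow_le' T n.succ_pos).trans (pow_le_one₀ (norm_nonneg _) hT)

variable {A : Type*} [NormedRing A] [NormedAlgebra ℝ A]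

theorem norm_FOp_le {T : A} (h1 : ‖(1 : A)‖ ≤ 1) (hT : ‖T‖ ≤ 1) (hu : IsUnit (1 - T))
    {m : ℕ} (hm : 0 < m) :
    ‖FOp m T‖ ≤ 4 * ‖Ring.inverse (1 - T) ^ 2‖ := by
  obtain ⟨n, rfl⟩ : ∃ n, m = n + 1 := ⟨m - 1, by omega⟩
  have hinv : Ring.inverse (1 - T) ^ 2 * (1 - T) ^ 2 = 1 := by
    rw [sq, sq, mul_assoc, ← mul_assoc (Ring.inverse (1 - T)) (1 - T),
      Ring.inverse_mul_cancel _ hu, one_mul, Ring.inverse_mul_cancel _ hu]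
  have hF : FOp (n + 1) T = (2 / ((n : ℝ) + 1)) • (Ring.inverse (1 - T) ^ 2 *
      ((n : ℝ) • (1 : A) - ((n : ℝ) + 1) • T + T ^ (n + 1))) := by
    rw [← one_sub_sq_mul_sum, ← mul_assoc, hinv, one_mul, FOp_succ]
  have hn : (0 : ℝ) ≤ n := n.cast_nonneg
  -- The three terms contribute `n`, `n + 1` and `1`, in total `2m` with `m = n + 1`; the prefactor
  -- `2 / m` then leaves `4`.
  have hP : ‖(n : ℝ) • (1 : A) - ((n : ℝ) + 1) • T + T ^ (n + 1)‖ ≤ 2 * (n + 1) := by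
    calc _ ≤ ‖(n : ℝ) • (1 : A)‖ + ‖((n : ℝ) + 1) • T‖ + ‖T ^ (n + 1)‖ :=
          (norm_add_le _ _).trans (by gcongr; exact norm_sub_le _ _)
      _ ≤ n * 1 + (n + 1) * 1 + 1 := by
          rw [norm_smul, norm_smul, Real.norm_of_nonneg hn,
            Real.norm_of_nonneg (by positivity : (0 : ℝ) ≤ (n : ℝ) + 1)]
          gcongr
          exact norm_pow_succ_le_one hT n
      _ = _ := by ring
  rw [hF, norm_smul, Real.norm_of_nonneg (by positivity)]
  calc _ ≤ 2 / ((n : ℝ) + 1) * (‖Ring.inverse (1 - T) ^ 2‖ * (2 * (n + 1))) := by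
        gcongr
        exact (norm_mul_le _ _).trans (by gcongr)
    _ = _ := by field_simp; ring

theorem norm_inverse_one_sub_le {A : Type*} [NormedRing A] {T : A} (h1 : ‖(1 : A)‖ ≤ 1) (hT : ‖T‖ ≤ 1)
    (hu : IsUnit (1 - T)) :
    ‖Ring.inverse (1 - T)‖ ≤ 2 * ‖Ring.inverse (1 - T) ^ 2‖ := by
  have e : Ring.inverse (1 - T) = (1 - T) * Ring.inverse (1 - T) ^ 2 := by
    rw [sq, ← mul_assoc, Ring.mul_inverse_cancel _ hu, one_mul]
  calc ‖Ring.inverse (1 - T)‖ = ‖(1 - T) * Ring.inverse (1 - T) ^ 2‖ := by rw [← e]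
    _ ≤ ‖1 - T‖ * ‖Ring.inverse (1 - T) ^ 2‖ := norm_mul_le _ _
    _ ≤ _ := by gcongr; exact norm_one_sub_le h1 hT

theorem one_le_norm_inverse_one_sub_sq {A : Type*} [NormedRing A] [NormOneClass A] {T : A} (hT : ‖T‖ ≤ 1)
    (hu : IsUnit (1 - T)) :
    1 ≤ 4 * ‖Ring.inverse (1 - T) ^ 2‖ := by
  have e : (1 - T) * Ring.inverse (1 - T) = 1 := Ring.mul_inverse_cancel _ hu
  have h : (1 : ℝ) ≤ 2 * ‖Ring.inverse (1 - T)‖ := by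
    calc (1 : ℝ) = ‖(1 - T) * Ring.inverse (1 - T)‖ := by rw [e, norm_one]
      _ ≤ _ := (norm_mul_le _ _).trans (by gcongr; exact norm_one_sub_le norm_one.le hT)
  linarith [norm_inverse_one_sub_le norm_one.le hT hu]

end FOp

/-! ### The Hilbert-Schmidt norm as a double sum -/

section HilbertSchmidt

variable {H : Type*} [NormedAddCommGroup H] [InnerProductSpace ℝ H]

theorem tsum_enorm_inner_sq {ι : Type*} (b : HilbertBasis ι ℝ H) (x : H) :
    ∑' i, ENNReal.ofReal (⟪x, b i⟫_ℝ ^ 2) = ENNReal.ofReal (‖x‖ ^ 2) := by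
  have h := b.hasSum_inner_mul_inner x x
  simp only [real_inner_comm x, ← sq, real_inner_self_eq_norm_sq] at h
  rw [← h.tsum_eq, ENNReal.ofReal_tsum_of_nonneg (fun i => sq_nonneg _) h.summable]

variable [CompleteSpace H]

/-- Parseval for `T`, then for its adjoint, exchanges the basis `b` for `c`, so the Hilbert–Schmidt
norm does not depend on the basis. In `ℝ≥0∞` the sums commute without summability conditions. -/
theorem tsum_norm_apply_sq {ι κ : Type*} (b : HilbertBasis ι ℝ H) (c : HilbertBasis κ ℝ H)
    (T : H →L[ℝ] H) :
    ∑' i, ENNReal.ofReal (‖T (b i)‖ ^ 2) =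
      ∑' p : κ × κ, ENNReal.ofReal (⟪c p.2, T (c p.1)⟫_ℝ ^ 2) := by
  calc _ = ∑' i, ∑' j, ENNReal.ofReal (⟪T (b i), c j⟫_ℝ ^ 2) := by
        simp only [tsum_enorm_inner_sq]
    _ = ∑' j, ∑' i, ENNReal.ofReal (⟪T (b i), c j⟫_ℝ ^ 2) := ENNReal.tsum_comm
    _ = ∑' j, ∑' i, ENNReal.ofReal (⟪T.adjoint (c j), b i⟫_ℝ ^ 2) := by
        simp only [ContinuousLinearMap.adjoint_inner_left, real_inner_comm]
    _ = ∑' j, ∑' i, ENNReal.ofReal (⟪T.adjoint (c j), c i⟫_ℝ ^ 2) := by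
        simp only [tsum_enorm_inner_sq]
    _ = ∑' i, ∑' j, ENNReal.ofReal (⟪c j, T (c i)⟫_ℝ ^ 2) := by
        rw [ENNReal.tsum_comm]
        simp only [ContinuousLinearMap.adjoint_inner_left]
    _ = _ := (ENNReal.tsum_prod (f := fun i j => ENNReal.ofReal (⟪c j, T (c i)⟫_ℝ ^ 2))).symm

theorem summable_iff_tsum_ofReal_ne_top {ι : Type*} {f : ι → ℝ} (hf : ∀ i, 0 ≤ f i) :
    Summable f ↔ ∑' i, ENNReal.ofReal (f i) ≠ ∞ := by
  refine ⟨fun h => h.tsum_ofReal_ne_top, fun h => ?_⟩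
  have := ENNReal.summable_toReal h
  simpa only [ENNReal.toReal_ofReal (hf _)] using this

theorem isHilbertSchmidt_of_summable {κ : Type*} (c : HilbertBasis κ ℝ H) {T : H →L[ℝ] H}
    (h : Summable fun p : κ × κ => ⟪c p.2, T (c p.1)⟫_ℝ ^ 2) : IsHilbertSchmidt T := by
  rw [summable_iff_tsum_ofReal_ne_top fun _ => sq_nonneg _] at h
  rw [IsHilbertSchmidt, summable_iff_tsum_ofReal_ne_top fun _ => sq_nonneg _,
    tsum_norm_apply_sq _ c]
  exact h

theorem hasSum_hsNormSq {κ : Type*} (c : HilbertBasis κ ℝ H) {T : H →L[ℝ] H}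
    (h : Summable fun p : κ × κ => ⟪c p.2, T (c p.1)⟫_ℝ ^ 2) :
    HasSum (fun p : κ × κ => ⟪c p.2, T (c p.1)⟫_ℝ ^ 2) (hsNormSq T) := by
  have hT := isHilbertSchmidt_of_summable c h
  have e := tsum_norm_apply_sq (someBasis H) c T
  rw [← ENNReal.ofReal_tsum_of_nonneg (fun _ => sq_nonneg _) hT,
    ← ENNReal.ofReal_tsum_of_nonneg (fun _ => sq_nonneg _) h,
    ENNReal.ofReal_eq_ofReal_iff (tsum_nonneg fun _ => sq_nonneg _)
      (tsum_nonneg fun _ => sq_nonneg _)] at e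
  rw [hsNormSq, e]
  exact h.hasSum

end HilbertSchmidt

/-! ### Markov operators on `L²(μ)` -/

section MarkovOperator

variable {α : Type*} [MeasurableSpace α] {μ : Measure α} [IsFiniteMeasure μ]

/-- A Markov operator on `L²(μ)`: positive and unital. -/
structure IsMarkovOp (P : Lp ℝ 2 μ →L[ℝ] Lp ℝ 2 μ) : Prop where
  nonneg : ∀ u : Lp ℝ 2 μ, (∀ᵐ x ∂μ, 0 ≤ u x) → ∀ᵐ x ∂μ, 0 ≤ P u x
  one : P (Lp.const 2 μ 1) = Lp.const 2 μ 1

/-- By density the inequality holds for real `q`, and `q = a` minimises the quadratic. -/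
theorem sq_le_of_forall_rat {a b : ℝ} (h : ∀ q : ℚ, 0 ≤ b - 2 * q * a + (q : ℝ) ^ 2) :
    a ^ 2 ≤ b := by
  have hr : ∀ r : ℝ, 0 ≤ b - 2 * r * a + r ^ 2 := fun r =>
    Rat.denseRange_cast.induction_on (p := fun r : ℝ => 0 ≤ b - 2 * r * a + r ^ 2) r
      (isClosed_le continuous_const (by fun_prop)) h
  linarith [hr a]

/-- Jensen's inequality for the square: `(P u)² ≤ P (u²)`. -/
theorem IsMarkovOp.sq_le {P : Lp ℝ 2 μ →L[ℝ] Lp ℝ 2 μ} (hP : IsMarkovOp P) {u v : Lp ℝ 2 μ}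
    (huv : ∀ᵐ x ∂μ, v x = u x ^ 2) : ∀ᵐ x ∂μ, P u x ^ 2 ≤ P v x := by
  -- Positivity applied to `(u - q)² = u² - 2qu + q²`. Restricting to rational `q` leaves countably
  -- many null sets to discard.
  have key : ∀ q : ℚ, ∀ᵐ x ∂μ, 0 ≤ P v x - 2 * q * P u x + (q : ℝ) ^ 2 := by
    intro q
    have e : ∀ a b c : Lp ℝ 2 μ, ∀ᵐ x ∂μ, (a - (2 * (q : ℝ)) • b + ((q : ℝ) ^ 2) • c) x =
        a x - 2 * q * b x + (q : ℝ) ^ 2 * c x := by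
      intro a b c
      filter_upwards [Lp.coeFn_add (a - (2 * (q : ℝ)) • b) (((q : ℝ) ^ 2) • c),
        Lp.coeFn_sub a ((2 * (q : ℝ)) • b), Lp.coeFn_smul (2 * (q : ℝ)) b,
        Lp.coeFn_smul ((q : ℝ) ^ 2) c] with x h1 h2 h3 h4
      simp only [h1, h2, h3, h4, Pi.add_apply, Pi.sub_apply, Pi.smul_apply, smul_eq_mul]
    have hc := Lp.coeFn_const (p := 2) (μ := μ) (c := (1 : ℝ))
    have hn := hP.nonneg (v - (2 * (q : ℝ)) • u + ((q : ℝ) ^ 2) • Lp.const 2 μ 1) (by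
      filter_upwards [e v u (Lp.const 2 μ 1), huv, hc] with x h1 h2 h3
      rw [h1, h2, h3, Function.const_apply]
      nlinarith [sq_nonneg (u x - q)])
    rw [map_add, map_sub, map_smul, map_smul, hP.one] at hn
    filter_upwards [hn, e (P v) (P u) (Lp.const 2 μ 1), hc] with x h1 h2 h3
    rw [h2, h3, Function.const_apply, mul_one] at h1
    exact h1
  filter_upwards [ae_all_iff.2 key] with x hx
  exact sq_le_of_forall_rat hx

theorem IsMarkovOp.mono {P : Lp ℝ 2 μ →L[ℝ] Lp ℝ 2 μ} (hP : IsMarkovOp P) {u v : Lp ℝ 2 μ}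
    (huv : ∀ᵐ x ∂μ, u x ≤ v x) : ∀ᵐ x ∂μ, P u x ≤ P v x := by
  have h := hP.nonneg (v - u) (by
    filter_upwards [huv, Lp.coeFn_sub v u] with x h1 h2
    rw [h2, Pi.sub_apply]
    linarith)
  rw [map_sub] at h
  filter_upwards [h, Lp.coeFn_sub (P v) (P u)] with x h1 h2
  rw [h2, Pi.sub_apply] at h1
  linarith

theorem integrable_mul_L2 {α : Type*} [MeasurableSpace α] {μ : Measure α} (u v : Lp ℝ 2 μ) : Integrable (fun x => u x * v x) μ :=
  (Lp.memLp u).integrable_mul (Lp.memLp v)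

theorem inner_eq_integral_mul {α : Type*} [MeasurableSpace α] {μ : Measure α} (u v : Lp ℝ 2 μ) : ⟪u, v⟫_ℝ = ∫ x, u x * v x ∂μ := by
  rw [L2.inner_def]
  exact integral_congr_ae (Filter.Eventually.of_forall fun x => mul_comm _ _)

theorem inner_nonneg_of_ae {α : Type*} [MeasurableSpace α] {μ : Measure α} {u v : Lp ℝ 2 μ} (hu : ∀ᵐ x ∂μ, 0 ≤ u x) (hv : ∀ᵐ x ∂μ, 0 ≤ v x) :
    0 ≤ ⟪u, v⟫_ℝ := by
  rw [L2.inner_def]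
  refine integral_nonneg_of_ae ?_
  filter_upwards [hu, hv] with x h1 h2
  simpa using mul_nonneg h2 h1

/-- Testing against indicators of measurable sets suffices. -/
theorem nonneg_of_forall_inner {u : Lp ℝ 2 μ}
    (h : ∀ v : Lp ℝ 2 μ, (∀ᵐ x ∂μ, 0 ≤ v x) → 0 ≤ ⟪u, v⟫_ℝ) : ∀ᵐ x ∂μ, 0 ≤ u x := by
  refine ae_nonneg_of_forall_setIntegral_nonneg ((Lp.memLp u).integrable (by norm_num))
    fun s hs hμs => ?_
  have hi := h (indicatorConstLp 2 hs hμs.ne (1 : ℝ)) (by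
    filter_upwards [indicatorConstLp_coeFn (p := 2) (hs := hs) (hμs := hμs.ne) (c := (1 : ℝ))]
      with x hx
    rw [hx]
    exact Set.indicator_nonneg (fun _ _ => zero_le_one) x)
  rwa [real_inner_comm, L2.inner_indicatorConstLp_one] at hi

/-- Positivity passes to the adjoint by duality of the positive cone; `h1`, preservation of the
integral, is exactly `P* 1 = 1`. -/
theorem IsMarkovOp.adjoint {P : Lp ℝ 2 μ →L[ℝ] Lp ℝ 2 μ} (hP : IsMarkovOp P)
    (h1 : ∀ u, ⟪Lp.const 2 μ (1 : ℝ), P u⟫_ℝ = ⟪Lp.const 2 μ (1 : ℝ), u⟫_ℝ) :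
    IsMarkovOp (ContinuousLinearMap.adjoint P) where
  nonneg u hu := nonneg_of_forall_inner fun v hv => by
    rw [ContinuousLinearMap.adjoint_inner_left]
    exact inner_nonneg_of_ae hu (hP.nonneg v hv)
  one := ext_inner_right ℝ fun v => by rw [ContinuousLinearMap.adjoint_inner_left, h1]

theorem inner_const_one (u : Lp ℝ 2 μ) : ⟪Lp.const 2 μ (1 : ℝ), u⟫_ℝ = ∫ x, u x ∂μ := by
  rw [L2.inner_def]
  refine integral_congr_ae ?_
  filter_upwards [Lp.coeFn_const (p := 2) (μ := μ) (c := (1 : ℝ))] with x hx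
  rw [hx]
  simp

variable {κ : Kernel α α} [IsMarkovKernel κ]

theorem integral_koopman (hκ : κ.Invariant μ) (ψ : Lp ℝ 2 μ) :
    ∫ x, koopman κ hκ ψ x ∂μ = ∫ x, ψ x ∂μ := by
  have hi : Integrable ψ (μ.bind κ) := by
    rw [hκ.def]; exact (Lp.memLp ψ).integrable (by norm_num)
  rw [integral_congr_ae (coeFn_koopman hκ ψ)]
  rw [Measure.comp_eq_comp_const_apply] at hi
  have h := Kernel.integral_comp hi
  rw [← Measure.comp_eq_comp_const_apply, hκ.def, Kernel.const_apply] at h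
  exact h.symm

theorem isMarkovOp_koopman (hκ : κ.Invariant μ) : IsMarkovOp (koopman κ hκ) where
  nonneg u hu := by
    have h' : ∀ᵐ y ∂(μ.bind κ), 0 ≤ u y := by rw [hκ.def]; exact hu
    filter_upwards [coeFn_koopman hκ u, Measure.ae_ae_of_ae_comp h'] with x hx h
    rw [hx]
    exact integral_nonneg_of_ae h
  one := by
    refine Lp.ext ?_
    have hc := Lp.coeFn_const (p := 2) (μ := μ) (c := (1 : ℝ))
    refine (coeFn_koopman hκ _).trans ((koopmanFun_congr hκ hc).trans ?_)
    refine Filter.EventuallyEq.trans (Filter.Eventually.of_forall fun x => ?_) hc.symm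
    simp [koopmanFun]

theorem isMarkovOp_adjoint_koopman (hκ : κ.Invariant μ) :
    IsMarkovOp (ContinuousLinearMap.adjoint (koopman κ hκ)) :=
  (isMarkovOp_koopman hκ).adjoint fun u => by
    rw [inner_const_one, inner_const_one, integral_koopman]

theorem norm_koopman_le (hκ : κ.Invariant μ) : ‖koopman κ hκ‖ ≤ 1 :=
  LinearMap.mkContinuous_norm_le _ zero_le_one _

theorem norm_koopman0_le (hκ : κ.Invariant μ) : ‖koopman0 κ hκ‖ ≤ 1 := by
  refine ContinuousLinearMap.opNorm_le_bound _ zero_le_one fun ψ => ?_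
  exact (koopman κ hκ).le_of_opNorm_le (norm_koopman_le hκ) (ψ : Lp ℝ 2 μ)

end MarkovOperator

/-! ### The Mercer basis and sums of products -/

section Mercer

variable {α : Type*} [TopologicalSpace α] [SecondCountableTopology α] [MeasurableSpace α]
  [OpensMeasurableSpace α] {H : Type*} [NormedAddCommGroup H] [InnerProductSpace ℝ H]
  [CompleteSpace H] [RKHS ℝ H α ℝ] {μ : Measure α} [IsFiniteMeasure μ]
  {h : Compatible H μ} {ι : Type*}

theorem coeFn_incl (h : Compatible H μ) (ψ : H) : incl h ψ =ᵐ[μ] ψ :=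
  MemLp.coeFn_toLp (h.memLp_coe ψ)

/-- This lets identities in `H` be checked in `L²(μ)`. -/
theorem incl_injective (h : Compatible H μ) : Function.Injective (incl h) := by
  rw [injective_iff_map_eq_zero]
  intro ψ hψ
  refine RKHS.ext (𝕜 := ℝ) fun x => ?_
  have : ∀ᵐ x ∂μ, ψ x = 0 := by
    filter_upwards [coeFn_incl h ψ, Lp.coeFn_zero ℝ 2 μ] with x h1 h2
    rw [← h1, hψ, h2, Pi.zero_apply]
  simpa using h.eq_zero_of_ae ψ this x

theorem inner_integralOp (h : Compatible H μ) (u : Lp ℝ 2 μ) (ψ : H) :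
    ⟪ψ, integralOp h u⟫_ℝ = ⟪incl h ψ, u⟫_ℝ := by
  rw [← adjoint_integralOp, ContinuousLinearMap.adjoint_inner_left]

theorem inner_crossCov (h : Compatible H μ) {κ : Kernel α α} [IsMarkovKernel κ]
    (hκ : κ.Invariant μ) (ψ η : H) :
    ⟪η, crossCov h κ hκ ψ⟫_ℝ = ⟪incl h η, koopman κ hκ (incl h ψ)⟫_ℝ :=
  inner_integralOp h _ η

namespace MercerBasis

variable (B : MercerBasis h ι)

theorem integralOp_e (i : ι) : integralOp h (B.e i) = √(B.lam i) • B.f i := by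
  refine incl_injective h ?_
  rw [← adjoint_integralOp, B.eigen, map_smul, adjoint_integralOp, B.f_eq, smul_smul,
    Real.mul_self_sqrt (B.lam_pos i).le]

/-- Translates coefficients along `f` in `H` into coefficients along `e` in `L²(μ)`; both
orthonormality and completeness of `f` in `H` follow from it. -/
theorem inner_f (i : ι) (ψ : H) : √(B.lam i) * ⟪ψ, B.f i⟫_ℝ = ⟪incl h ψ, B.e i⟫_ℝ := by
  rw [← inner_smul_right, ← integralOp_e, inner_integralOp]

theorem orthonormal_f : Orthonormal ℝ B.f := by
  classical
  rw [orthonormal_iff_ite]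
  intro i j
  have hj : √(B.lam j) ≠ 0 := (Real.sqrt_pos.2 (B.lam_pos j)).ne'
  refine mul_left_cancel₀ hj ?_
  rw [inner_f, f_eq, real_inner_smul_left, orthonormal_iff_ite.1 B.e.orthonormal]
  split_ifs with hij
  · rw [hij]
  · simp

theorem orthogonal_span_f : (Submodule.span ℝ (Set.range B.f))ᗮ = ⊥ := by
  rw [Submodule.eq_bot_iff]
  intro ψ hψ
  refine incl_injective h ?_
  rw [map_zero]
  refine B.e.repr.injective (lp.ext (funext fun i => ?_))
  rw [B.e.repr_apply_apply, real_inner_comm, ← inner_f,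
    Submodule.mem_orthogonal' _ _ |>.1 hψ _ (Submodule.subset_span ⟨i, rfl⟩)]
  simp

/-- The Mercer basis as an orthonormal basis of the reproducing kernel Hilbert space. -/
noncomputable def basis : HilbertBasis ι ℝ H :=
  HilbertBasis.mkOfOrthogonalEqBot B.orthonormal_f B.orthogonal_span_f

theorem coe_basis : ⇑B.basis = B.f :=
  HilbertBasis.coe_mkOfOrthogonalEqBot _ _

/-- Parseval for the feature vector `Φ(x)`, whose coefficients are `f_i(x)`. It holds at every `x`,
not just almost everywhere. -/
theorem hasSum_f_sq (x : α) : HasSum (fun i => B.f i x ^ 2) (diag H x) := by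
  have := B.basis.hasSum_inner_mul_inner (feature H x) (feature H x)
  rw [inner_feature_feature] at this
  have e : ∀ i, ⟪feature H x, B.f i⟫_ℝ = B.f i x := fun i => by
    rw [real_inner_comm, inner_feature]
  simpa only [coe_basis, e, inner_feature, ← sq, diag] using this

end MercerBasis

/-- The reproducing property gives `ψ(x)² ≤ ‖ψ‖² φ(x)`, and `φ` is in `L²(μ)`. -/
theorem memLp_sq (h : Compatible H μ) (ψ : H) : MemLp (fun x => ψ x ^ 2) 2 μ := by
  refine MemLp.of_le_mul (c := ‖ψ‖ ^ 2) h.memLp_diag ((h.memLp_coe ψ).1.pow 2)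
    (Filter.Eventually.of_forall fun x => ?_)
  have h1 : |ψ x| ≤ ‖ψ‖ * ‖feature H x‖ := by
    rw [← inner_feature H ψ x]
    exact abs_real_inner_le_norm _ _
  have h2 : diag H x = ‖feature H x‖ ^ 2 := by
    rw [← real_inner_self_eq_norm_sq, inner_feature_feature, diag]
  rw [h2, Real.norm_of_nonneg (sq_nonneg _), Real.norm_of_nonneg (sq_nonneg _), ← mul_pow, ← sq_abs]
  gcongr

/-- The class of `ψ²` in `L²(μ)`, for `ψ` in the reproducing kernel Hilbert space. -/
noncomputable def sqClass (h : Compatible H μ) (ψ : H) : Lp ℝ 2 μ := (memLp_sq h ψ).toLp _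

theorem coeFn_sqClass (h : Compatible H μ) (ψ : H) : ∀ᵐ x ∂μ, sqClass h ψ x = ψ x ^ 2 :=
  MemLp.coeFn_toLp (memLp_sq h ψ)

theorem coeFn_sum_sqClass (B : MercerBasis h ι) (s : Finset ι) :
    ∀ᵐ x ∂μ, (∑ i ∈ s, sqClass h (B.f i)) x = ∑ i ∈ s, B.f i x ^ 2 := by
  classical
  induction s using Finset.induction_on with
  | empty =>
    filter_upwards [Lp.coeFn_zero ℝ 2 μ] with x hx
    rw [Finset.sum_empty, Finset.sum_empty, hx, Pi.zero_apply]
  | insert i s hi ih =>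
    rw [Finset.sum_insert hi]
    filter_upwards [ih, coeFn_sqClass h (B.f i), Lp.coeFn_add (sqClass h (B.f i))
      (∑ i ∈ s, sqClass h (B.f i))] with x h1 h2 h3
    rw [h3, Pi.add_apply, h1, h2, Finset.sum_insert hi]

theorem sum_sqClass_le (B : MercerBasis h ι) (s : Finset ι) :
    ∀ᵐ x ∂μ, (∑ i ∈ s, sqClass h (B.f i)) x ≤ h.memLp_diag.toLp _ x := by
  filter_upwards [coeFn_sum_sqClass B s, h.memLp_diag.coeFn_toLp] with x h1 h2
  rw [h1, h2]
  exact sum_le_hasSum s (fun _ _ => sq_nonneg _) (B.hasSum_f_sq x)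

variable {P : Lp ℝ 2 μ →L[ℝ] Lp ℝ 2 μ}

/-- The product `ψ · P η`. -/
noncomputable def mulMarkov (h : Compatible H μ) (P : Lp ℝ 2 μ →L[ℝ] Lp ℝ 2 μ) (η ψ : H) : α → ℝ :=
  fun x => ψ x * P (incl h η) x

theorem mulMarkov_sq_le (hP : IsMarkovOp P) (η ψ : H) :
    ∀ᵐ x ∂μ, mulMarkov h P η ψ x ^ 2 ≤ sqClass h ψ x * P (sqClass h η) x := by
  have h1 : ∀ᵐ x ∂μ, sqClass h η x = incl h η x ^ 2 := by
    filter_upwards [coeFn_sqClass h η, coeFn_incl h η] with x h1 h2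
    rw [h1, h2]
  filter_upwards [hP.sq_le h1, coeFn_sqClass h ψ] with x h2 h3
  rw [mulMarkov, mul_pow, h3]
  gcongr

theorem aestronglyMeasurable_mulMarkov (η ψ : H) :
    AEStronglyMeasurable (mulMarkov h P η ψ) μ :=
  (h.memLp_coe ψ).1.mul (Lp.memLp (P (incl h η))).1

theorem memLp_mulMarkov (hP : IsMarkovOp P) (η ψ : H) : MemLp (mulMarkov h P η ψ) 2 μ := by
  rw [memLp_two_iff_integrable_sq (aestronglyMeasurable_mulMarkov η ψ)]
  refine (integrable_mul_L2 (sqClass h ψ) (P (sqClass h η))).mono'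
    ((aestronglyMeasurable_mulMarkov η ψ).pow 2) ?_
  filter_upwards [mulMarkov_sq_le hP η ψ] with x hx
  rwa [Real.norm_of_nonneg (sq_nonneg _)]

theorem coeFn_classL2_mulMarkov (hP : IsMarkovOp P) (η ψ : H) :
    classL2 μ (mulMarkov h P η ψ) =ᵐ[μ] mulMarkov h P η ψ := by
  rw [classL2, dif_pos (memLp_mulMarkov hP η ψ)]
  exact MemLp.coeFn_toLp _

theorem norm_classL2_mulMarkov_sq_le (hP : IsMarkovOp P) (η ψ : H) :
    ‖classL2 μ (mulMarkov h P η ψ)‖ ^ 2 ≤ ⟪sqClass h ψ, P (sqClass h η)⟫_ℝ := by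
  rw [← real_inner_self_eq_norm_sq, inner_eq_integral_mul, inner_eq_integral_mul]
  refine integral_mono_ae (integrable_mul_L2 _ _) (integrable_mul_L2 _ _) ?_
  filter_upwards [coeFn_classL2_mulMarkov hP η ψ, mulMarkov_sq_le hP η ψ] with x h1 h2
  rwa [h1, ← sq]

theorem inner_one_classL2_mulMarkov (hP : IsMarkovOp P) (η ψ : H) :
    ⟪Lp.const 2 μ (1 : ℝ), classL2 μ (mulMarkov h P η ψ)⟫_ℝ = ⟪incl h ψ, P (incl h η)⟫_ℝ := by
  rw [inner_const_one, inner_eq_integral_mul]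
  refine integral_congr_ae ?_
  filter_upwards [coeFn_classL2_mulMarkov hP η ψ, coeFn_incl h ψ] with x h1 h2
  rw [h1, h2, mulMarkov]

/-- Enlarging `s` to a rectangle makes the bound factor as `⟨b, P a⟩` with `a`, `b` finite sums of
squares. Both lie below `φ`, so positivity of `P` finishes without any convergence of the Mercer
series in `L²(μ)`. -/
theorem sum_norm_mulMarkov_sq_le (hP : IsMarkovOp P) (B : MercerBasis h ι) (s : Finset (ι × ι)) :
    ∑ p ∈ s, ‖classL2 μ (mulMarkov h P (B.f p.1) (B.f p.2))‖ ^ 2 ≤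
      ⟪h.memLp_diag.toLp _, P (h.memLp_diag.toLp _)⟫_ℝ := by
  classical
  set a : Lp ℝ 2 μ := ∑ i ∈ s.image Prod.fst, sqClass h (B.f i) with ha
  set b : Lp ℝ 2 μ := ∑ j ∈ s.image Prod.snd, sqClass h (B.f j) with hb
  have hb0 : ∀ᵐ x ∂μ, 0 ≤ b x := by
    filter_upwards [coeFn_sum_sqClass B (s.image Prod.snd)] with x hx
    rw [hx]
    exact Finset.sum_nonneg fun _ _ => sq_nonneg _
  have hφ0 : ∀ᵐ x ∂μ, 0 ≤ h.memLp_diag.toLp _ x := by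
    filter_upwards [sum_sqClass_le B (s.image Prod.snd), hb0] with x h1 h2
    exact h2.trans h1
  calc _ ≤ ∑ p ∈ s.image Prod.fst ×ˢ s.image Prod.snd,
          ‖classL2 μ (mulMarkov h P (B.f p.1) (B.f p.2))‖ ^ 2 :=
        Finset.sum_le_sum_of_subset_of_nonneg Finset.subset_product fun _ _ _ => sq_nonneg _
    _ ≤ ∑ p ∈ s.image Prod.fst ×ˢ s.image Prod.snd,
          ⟪sqClass h (B.f p.2), P (sqClass h (B.f p.1))⟫_ℝ :=
        Finset.sum_le_sum fun p _ => norm_classL2_mulMarkov_sq_le hP _ _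
    _ = ⟪b, P a⟫_ℝ := by
        rw [ha, hb, map_sum, sum_inner, Finset.sum_product_right]
        simp only [inner_sum]
    _ ≤ _ := by
        rw [inner_eq_integral_mul, inner_eq_integral_mul]
        refine integral_mono_ae (integrable_mul_L2 _ _) (integrable_mul_L2 _ _) ?_
        filter_upwards [hb0, hφ0, sum_sqClass_le B (s.image Prod.snd),
          hP.mono (sum_sqClass_le B (s.image Prod.fst)), hP.nonneg _ hφ0] with x h1 h2 h3 h4 h5
        exact (mul_le_mul_of_nonneg_left h4 h1).trans (mul_le_mul_of_nonneg_right h3 h5)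

end Mercer

/-! ### Centering -/

section Center

variable {α : Type*} [MeasurableSpace α] {μ : Measure α} [IsProbabilityMeasure μ]

theorem inner_one_one : ⟪Lp.const 2 μ (1 : ℝ), Lp.const 2 μ (1 : ℝ)⟫_ℝ = 1 := by
  rw [inner_const_one,
    integral_congr_ae (Lp.coeFn_const (p := 2) (μ := μ) (c := (1 : ℝ)))]
  simp

theorem sub_mean_mem_L20 (u : Lp ℝ 2 μ) :
    u - ⟪Lp.const 2 μ (1 : ℝ), u⟫_ℝ • Lp.const 2 μ (1 : ℝ) ∈ L20 μ := by
  rw [L20, Submodule.mem_orthogonal_singleton_iff_inner_right, inner_sub_right, inner_smul_right,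
    inner_one_one, mul_one, sub_self]

theorem coe_projQ (u : Lp ℝ 2 μ) :
    (projQ μ u : Lp ℝ 2 μ) = u - ⟪Lp.const 2 μ (1 : ℝ), u⟫_ℝ • Lp.const 2 μ (1 : ℝ) := by
  have : (L20 μ).HasOrthogonalProjection := by unfold L20; infer_instance
  refine Submodule.eq_starProjection_of_mem_of_inner_eq_zero (sub_mean_mem_L20 u) fun w hw => ?_
  rw [L20, Submodule.mem_orthogonal_singleton_iff_inner_right] at hw
  rw [sub_sub_cancel, real_inner_smul_left, hw, mul_zero]

/-- Pythagoras; `μ` being a probability measure makes the constant `1` a unit vector. -/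
theorem norm_projQ_sq (u : Lp ℝ 2 μ) :
    ‖projQ μ u‖ ^ 2 = ‖u‖ ^ 2 - ⟪Lp.const 2 μ (1 : ℝ), u⟫_ℝ ^ 2 := by
  rw [Submodule.coe_norm, coe_projQ, ← real_inner_self_eq_norm_sq, ← real_inner_self_eq_norm_sq]
  simp only [inner_sub_left, inner_sub_right, real_inner_smul_left, inner_smul_right,
    inner_one_one, real_inner_comm (Lp.const 2 μ (1 : ℝ)) u]
  ring

theorem eq_mean_smul_one [Subsingleton (L20 μ)] (u : Lp ℝ 2 μ) :
    u = ⟪Lp.const 2 μ (1 : ℝ), u⟫_ℝ • Lp.const 2 μ (1 : ℝ) := by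
  have := Subsingleton.elim (⟨_, sub_mean_mem_L20 u⟩ : L20 μ) 0
  rw [← sub_eq_zero]
  exact congrArg Subtype.val this

/-- When `L²(μ)` consists of constants, two basis vectors both have nonzero mean and their inner
product is the product of the means, so they cannot be orthogonal: the index has at most one
element. -/
theorem finite_index_of_subsingleton {ι : Type*} [Subsingleton (L20 μ)] (b : HilbertBasis ι ℝ (Lp ℝ 2 μ)) :
    Finite ι := by
  have hmul : ∀ i j, ⟪b i, b j⟫_ℝ =
      ⟪Lp.const 2 μ (1 : ℝ), b i⟫_ℝ * ⟪Lp.const 2 μ (1 : ℝ), b j⟫_ℝ := by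
    intro i j
    conv_lhs => rw [eq_mean_smul_one (b i), real_inner_smul_left]
  have hne : ∀ i, ⟪Lp.const 2 μ (1 : ℝ), b i⟫_ℝ ≠ 0 := fun i h0 => by
    have h1 := hmul i i
    rw [h0, zero_mul, inner_self_eq_zero] at h1
    exact b.orthonormal.ne_zero i h1
  have : Subsingleton ι := ⟨fun i j => by
    by_contra hij
    have h1 := hmul i j
    rw [b.orthonormal.inner_eq_zero hij] at h1
    exact mul_ne_zero (hne i) (hne j) h1.symm⟩
  infer_instance

end Center

/-! ### The bound on the variance -/

section Bound

variable {α : Type*} [TopologicalSpace α] [SecondCountableTopology α] [MeasurableSpace α]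
  [OpensMeasurableSpace α] {H : Type*} [NormedAddCommGroup H] [InnerProductSpace ℝ H]
  [CompleteSpace H] [RKHS ℝ H α ℝ] {μ : Measure α} [IsProbabilityMeasure μ]
  {h : Compatible H μ} {ι : Type*} {P : Lp ℝ 2 μ →L[ℝ] Lp ℝ 2 μ}

theorem summable_norm_mulMarkov_sq (hP : IsMarkovOp P) (B : MercerBasis h ι) :
    Summable fun p : ι × ι => ‖classL2 μ (mulMarkov h P (B.f p.1) (B.f p.2))‖ ^ 2 :=
  summable_of_sum_le (fun _ => sq_nonneg _) (sum_norm_mulMarkov_sq_le hP B)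

theorem summable_inner_sq (hP : IsMarkovOp P) (B : MercerBasis h ι) :
    Summable fun p : ι × ι => ⟪incl h (B.f p.2), P (incl h (B.f p.1))⟫_ℝ ^ 2 := by
  refine Summable.of_nonneg_of_le (fun _ => sq_nonneg _) (fun p => ?_)
    (summable_norm_mulMarkov_sq hP B)
  rw [← inner_one_classL2_mulMarkov hP, ← sub_nonneg, ← norm_projQ_sq]
  exact sq_nonneg _

theorem exists_hasSum_projQ_mulMarkov (hP : IsMarkovOp P) (B : MercerBasis h ι) {c : ℝ}
    (hc : HasSum (fun p : ι × ι => ⟪incl h (B.f p.2), P (incl h (B.f p.1))⟫_ℝ ^ 2) c) :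
    ∃ M, M ≤ ⟪h.memLp_diag.toLp _, P (h.memLp_diag.toLp _)⟫_ℝ - c ∧
      HasSum (fun p : ι × ι =>
        ‖projQ μ (classL2 μ (mulMarkov h P (B.f p.1) (B.f p.2)))‖ ^ 2) M := by
  have hs := summable_norm_mulMarkov_sq hP B
  refine ⟨_, sub_le_sub_right (hs.tsum_le_of_sum_le (sum_norm_mulMarkov_sq_le hP B)) c, ?_⟩
  simp only [norm_projQ_sq, inner_one_classL2_mulMarkov hP]
  exact hs.hasSum.sub hc

variable {κ : Kernel α α} [IsMarkovKernel κ]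

theorem summable_inner_crossCov_sq (B : MercerBasis h ι) (hκ : κ.Invariant μ) :
    Summable fun p : ι × ι => ⟪B.basis p.2, crossCov h κ hκ (B.basis p.1)⟫_ℝ ^ 2 := by
  simp only [inner_crossCov, B.coe_basis]
  exact summable_inner_sq (isMarkovOp_koopman hκ) B

theorem isHilbertSchmidt_crossCov (B : MercerBasis h ι) (hκ : κ.Invariant μ) :
    IsHilbertSchmidt (crossCov h κ hκ) :=
  isHilbertSchmidt_of_summable B.basis (summable_inner_crossCov_sq B hκ)

theorem hasSum_hsNormSq_crossCov (B : MercerBasis h ι) (hκ : κ.Invariant μ) :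
    HasSum (fun p : ι × ι => ⟪incl h (B.f p.2), koopman κ hκ (incl h (B.f p.1))⟫_ℝ ^ 2)
      (hsNormSq (crossCov h κ hκ)) := by
  have := hasSum_hsNormSq B.basis (summable_inner_crossCov_sq B hκ)
  simpa only [inner_crossCov, B.coe_basis] using this

theorem exists_hasSum_projQ_g (B : MercerBasis h ι) (hκ : κ.Invariant μ) :
    ∃ M, M ≤ E0 h κ hκ ∧
      HasSum (fun p : ι × ι => ‖projQ μ (classL2 μ (g B κ hκ p.1 p.2))‖ ^ 2) M := by
  rw [E0, real_inner_comm]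
  exact exists_hasSum_projQ_mulMarkov (isMarkovOp_koopman hκ) B (hasSum_hsNormSq_crossCov B hκ)

theorem gStar_eq (B : MercerBasis h ι) (hκ : κ.Invariant μ) (i j : ι) :
    gStar B κ hκ j i =
      mulMarkov h (ContinuousLinearMap.adjoint (koopman κ hκ)) (B.f j) (B.f i) := rfl

theorem exists_hasSum_projQ_gStar (B : MercerBasis h ι) (hκ : κ.Invariant μ) :
    ∃ M, M ≤ E0 h κ hκ ∧
      HasSum (fun p : ι × ι => ‖projQ μ (classL2 μ (gStar B κ hκ p.2 p.1))‖ ^ 2) M := by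
  have hc : HasSum (fun p : ι × ι => ⟪incl h (B.f p.2),
      ContinuousLinearMap.adjoint (koopman κ hκ) (incl h (B.f p.1))⟫_ℝ ^ 2)
      (hsNormSq (crossCov h κ hκ)) := by
    have e : ∀ p : ι × ι, ⟪incl h (B.f p.2),
        ContinuousLinearMap.adjoint (koopman κ hκ) (incl h (B.f p.1))⟫_ℝ =
        ⟪incl h (B.f p.1), koopman κ hκ (incl h (B.f p.2))⟫_ℝ := fun p => by
      rw [ContinuousLinearMap.adjoint_inner_right, real_inner_comm]
    simp only [e]
    exact (Equiv.prodComm ι ι).hasSum_iff.2 (hasSum_hsNormSq_crossCov B hκ)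
  obtain ⟨M, hM, hs⟩ := exists_hasSum_projQ_mulMarkov (isMarkovOp_adjoint_koopman hκ) B hc
  have hE : ⟪h.memLp_diag.toLp _,
      ContinuousLinearMap.adjoint (koopman κ hκ) (h.memLp_diag.toLp _)⟫_ℝ =
      ⟪koopman κ hκ (h.memLp_diag.toLp _), h.memLp_diag.toLp _⟫_ℝ :=
    ContinuousLinearMap.adjoint_inner_right _ _ _
  refine ⟨M, ?_, ?_⟩
  · rwa [hE] at hM
  · simp only [gStar_eq]
    -- For `g*_ji` the adjoint acts on `f_j` rather than `f_i`, so the index pair is transposed.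
    have hswap := (Equiv.prodComm ι ι).hasSum_iff.2 hs
    exact hswap

theorem E0_nonneg (B : MercerBasis h ι) (hκ : κ.Invariant μ) : 0 ≤ E0 h κ hκ := by
  obtain ⟨M, hM, hs⟩ := exists_hasSum_projQ_g B hκ
  exact (hs.nonneg fun _ => sq_nonneg _).trans hM

/-- Splitting the product by `2ab ≤ a² + b²` costs nothing in the end, because both sums of squares
have the same bound `E0`. -/
theorem abs_crossTerm_le (B : MercerBasis h ι) (hκ : κ.Invariant μ) (S : L20 μ →L[ℝ] L20 μ)
    (i j : ι) :
    |crossTerm B κ hκ S i j| ≤ ‖S‖ / 2 * (‖projQ μ (classL2 μ (gStar B κ hκ j i))‖ ^ 2 +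
      ‖projQ μ (classL2 μ (g B κ hκ i j))‖ ^ 2) := by
  refine (abs_real_inner_le_norm _ _).trans ?_
  set a := projQ μ (classL2 μ (gStar B κ hκ j i))
  set b := projQ μ (classL2 μ (g B κ hκ i j))
  calc ‖a‖ * ‖S b‖ ≤ ‖a‖ * (‖S‖ * ‖b‖) := by gcongr; exact S.le_opNorm b
    _ = ‖S‖ * (‖a‖ * ‖b‖) := by ring
    _ ≤ ‖S‖ * ((‖a‖ ^ 2 + ‖b‖ ^ 2) / 2) := by
        gcongr
        linarith [two_mul_le_add_sq ‖a‖ ‖b‖]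
    _ = _ := by ring

theorem summable_crossTerm (B : MercerBasis h ι) (hκ : κ.Invariant μ) (S : L20 μ →L[ℝ] L20 μ) :
    Summable fun p : ι × ι => crossTerm B κ hκ S p.1 p.2 := by
  obtain ⟨M, -, hM⟩ := exists_hasSum_projQ_g B hκ
  obtain ⟨N, -, hN⟩ := exists_hasSum_projQ_gStar B hκ
  exact Summable.of_norm_bounded ((hN.summable.add hM.summable).mul_left (‖S‖ / 2))
    fun p => abs_crossTerm_le B hκ S p.1 p.2

theorem tsum_crossTerm_le (B : MercerBasis h ι) (hκ : κ.Invariant μ) (S : L20 μ →L[ℝ] L20 μ) :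
    ∑' p : ι × ι, crossTerm B κ hκ S p.1 p.2 ≤ E0 h κ hκ * ‖S‖ := by
  obtain ⟨M, hME, hM⟩ := exists_hasSum_projQ_g B hκ
  obtain ⟨N, hNE, hN⟩ := exists_hasSum_projQ_gStar B hκ
  have h1 := hasSum_le (fun p : ι × ι => (le_abs_self _).trans (abs_crossTerm_le B hκ S p.1 p.2))
    (summable_crossTerm B hκ S).hasSum ((hN.add hM).mul_left (‖S‖ / 2))
  refine h1.trans ?_
  nlinarith [norm_nonneg S]

/-- If all classes in `L²(μ)` are constant, `⟨u, K v⟩` is the product of the means and the mean of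
`f_i²` is the squared mean of `f_i`, so `⟨K φ, φ⟩` and `‖C‖²_HS` agree term by term. Finiteness of
`ι` makes `φ` a finite sum in `L²(μ)`. -/
theorem E0_eq_zero_of_subsingleton [Subsingleton (L20 μ)] (B : MercerBasis h ι)
    (hκ : κ.Invariant μ) : E0 h κ hκ = 0 := by
  have := finite_index_of_subsingleton B.e
  have := Fintype.ofFinite ι
  have hone := (isMarkovOp_koopman hκ).one
  have hK : ∀ u v, ⟪u, koopman κ hκ v⟫_ℝ =
      ⟪Lp.const 2 μ (1 : ℝ), u⟫_ℝ * ⟪Lp.const 2 μ (1 : ℝ), v⟫_ℝ := by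
    intro u v
    conv_lhs => rw [eq_mean_smul_one u, eq_mean_smul_one v]
    rw [map_smul, hone, real_inner_smul_left, inner_smul_right, inner_one_one, mul_one]
  have hsq : ∀ i, ⟪Lp.const 2 μ (1 : ℝ), sqClass h (B.f i)⟫_ℝ =
      ⟪Lp.const 2 μ (1 : ℝ), incl h (B.f i)⟫_ℝ ^ 2 := by
    intro i
    -- Since `u = ⟨1, u⟩ 1`, the squared mean `⟨1, u⟩²` equals `⟨u, u⟩ = ∫ u²`.
    rw [sq, ← hK, hK, ← real_inner_smul_left, ← eq_mean_smul_one, inner_const_one,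
      inner_eq_integral_mul]
    refine integral_congr_ae ?_
    filter_upwards [coeFn_sqClass h (B.f i), coeFn_incl h (B.f i)] with x h1 h2
    rw [h1, h2, sq]
  have hφ : h.memLp_diag.toLp _ = ∑ i, sqClass h (B.f i) := by
    refine Lp.ext ?_
    filter_upwards [h.memLp_diag.coeFn_toLp, coeFn_sum_sqClass B Finset.univ] with x h1 h2
    rw [h1, h2]
    exact (B.hasSum_f_sq x).unique (hasSum_fintype _)
  have hhs := (hasSum_hsNormSq_crossCov B hκ).unique (hasSum_fintype _)
  rw [E0, real_inner_comm, hK, hφ, inner_sum, hhs, Fintype.sum_mul_sum, Fintype.sum_prod_type,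
    sub_eq_zero]
  refine Finset.sum_congr rfl fun i _ => Finset.sum_congr rfl fun j _ => ?_
  rw [hK, hsq, hsq]
  ring

theorem E0_le_mul_norm_inverse_sq (B : MercerBasis h ι) (hκ : κ.Invariant μ)
    (hu : IsUnit (1 - koopman0 κ hκ)) :
    E0 h κ hκ ≤ E0 h κ hκ * (4 * ‖Ring.inverse (1 - koopman0 κ hκ) ^ 2‖) := by
  rcases subsingleton_or_nontrivial (L20 μ) with hL | hL
  · rw [E0_eq_zero_of_subsingleton B hκ, zero_mul]
  · exact le_mul_of_one_le_right (E0_nonneg B hκ)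
      (one_le_norm_inverse_one_sub_sq (A := L20 μ →L[ℝ] L20 μ) (norm_koopman0_le hκ) hu)

/-- The constant is `8 = 4 + 4`: one `4` absorbs the summand `1`, the other bounds `F_m`. -/
theorem E0_mul_one_add_norm_FOp_le (B : MercerBasis h ι) (hκ : κ.Invariant μ)
    (hu : IsUnit (1 - koopman0 κ hκ)) {m : ℕ} (hm : 0 < m) :
    E0 h κ hκ * (1 + ‖FOp m (koopman0 κ hκ)‖) ≤
      8 * E0 h κ hκ * ‖Ring.inverse (1 - koopman0 κ hκ) ^ 2‖ := by
  have h1 := E0_le_mul_norm_inverse_sq B hκ hu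
  have h2 := mul_le_mul_of_nonneg_left
    (norm_FOp_le (A := L20 μ →L[ℝ] L20 μ) ContinuousLinearMap.norm_id_le (norm_koopman0_le hκ) hu hm) (E0_nonneg B hκ)
  linarith

theorem sigmaInfSq_le (B : MercerBasis h ι) (hκ : κ.Invariant μ)
    (hu : IsUnit (1 - koopman0 κ hκ)) :
    sigmaInfSq B κ hκ ≤ 8 * E0 h κ hκ * ‖Ring.inverse (1 - koopman0 κ hκ) ^ 2‖ := by
  have h1 := E0_le_mul_norm_inverse_sq B hκ hu
  have h2 := mul_le_mul_of_nonneg_left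
    (norm_inverse_one_sub_le (A := L20 μ →L[ℝ] L20 μ) ContinuousLinearMap.norm_id_le (norm_koopman0_le hκ) hu)
    (E0_nonneg B hκ)
  have h3 := tsum_crossTerm_le B hκ (Ring.inverse (1 - koopman0 κ hκ))
  rw [sigmaInfSq]
  -- Again `4 + 4`: here the second `4` is the factor `2` in `sigmaInfSq` times the `2` in `‖(1 -
  -- T)⁻¹‖ ≤ 2 ‖(1 - T)⁻²‖`.
  linarith

theorem sigmaSq_le (B : MercerBasis h ι) (hκ : κ.Invariant μ) (m : ℕ) :
    sigmaSq B κ hκ m ≤ E0 h κ hκ * (1 + ‖FOp m (koopman0 κ hκ)‖) := by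
  rw [sigmaSq, mul_add, mul_one]
  gcongr
  exact tsum_crossTerm_le B hκ _

end Bound

end KoopmanRKHS

theorem corollary3p2 {d : ℕ} (X : Set (EuclideanSpace ℝ (Fin d)))
    {H : Type*} [NormedAddCommGroup H] [InnerProductSpace ℝ H] [CompleteSpace H] [RKHS ℝ H X ℝ]
    (μ : Measure X) [IsProbabilityMeasure μ] (h : KoopmanRKHS.Compatible H μ)
    (ρ : ℝ≥0 → Kernel X X) [∀ t, IsMarkovKernel (ρ t)]
    (hρ : KoopmanRKHS.IsTransitionSemigroup ρ)
    (hinv : ∀ t, (ρ t).Invariant μ) (herg : KoopmanRKHS.IsErgodic ρ μ)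
    (t : ℝ≥0) (ht : 0 < t)
    (hres : (1 : ℝ) ∈ resolventSet ℝ (KoopmanRKHS.koopman0 (ρ t) (hinv t)))
    {ι : Type*} (B : KoopmanRKHS.MercerBasis h ι) :
    -- the quantities below are well defined
    KoopmanRKHS.IsHilbertSchmidt (KoopmanRKHS.crossCov h (ρ t) (hinv t)) ∧
    (∀ i j, MemLp (KoopmanRKHS.g B (ρ t) (hinv t) i j) 2 μ) ∧
    (∀ i j, MemLp (KoopmanRKHS.gStar B (ρ t) (hinv t) j i) 2 μ) ∧
    -- the bound for every number `m` of samples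
    (∀ m : ℕ, 0 < m →
      Summable (fun p : ι × ι => KoopmanRKHS.crossTerm B (ρ t) (hinv t)
        (KoopmanRKHS.FOp m (KoopmanRKHS.koopman0 (ρ t) (hinv t))) p.1 p.2) ∧
      KoopmanRKHS.sigmaSq B (ρ t) (hinv t) m ≤
        KoopmanRKHS.E0 h (ρ t) (hinv t) *
          (1 + ‖KoopmanRKHS.FOp m (KoopmanRKHS.koopman0 (ρ t) (hinv t))‖) ∧
      KoopmanRKHS.E0 h (ρ t) (hinv t) *
          (1 + ‖KoopmanRKHS.FOp m (KoopmanRKHS.koopman0 (ρ t) (hinv t))‖) ≤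
        8 * KoopmanRKHS.E0 h (ρ t) (hinv t) *
          ‖Ring.inverse (1 - KoopmanRKHS.koopman0 (ρ t) (hinv t)) ^ 2‖) ∧
    -- the resulting bound for the asymptotic variance
    Summable (fun p : ι × ι => KoopmanRKHS.crossTerm B (ρ t) (hinv t)
      (Ring.inverse (1 - KoopmanRKHS.koopman0 (ρ t) (hinv t))) p.1 p.2) ∧
    KoopmanRKHS.sigmaInfSq B (ρ t) (hinv t) ≤
      8 * KoopmanRKHS.E0 h (ρ t) (hinv t) *
        ‖Ring.inverse (1 - KoopmanRKHS.koopman0 (ρ t) (hinv t)) ^ 2‖ := by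
  have hu : IsUnit (1 - KoopmanRKHS.koopman0 (ρ t) (hinv t)) := by
    have h1 := spectrum.mem_resolventSet_iff.1 hres
    rwa [map_one] at h1
  exact ⟨KoopmanRKHS.isHilbertSchmidt_crossCov B (hinv t),
    fun i j => KoopmanRKHS.memLp_mulMarkov (KoopmanRKHS.isMarkovOp_koopman (hinv t)) _ _,
    fun i j => KoopmanRKHS.memLp_mulMarkov (KoopmanRKHS.isMarkovOp_adjoint_koopman (hinv t)) _ _,
    fun m hm => ⟨KoopmanRKHS.summable_crossTerm B (hinv t) _,
      KoopmanRKHS.sigmaSq_le B (hinv t) m,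
      KoopmanRKHS.E0_mul_one_add_norm_FOp_le B (hinv t) hu hm⟩,
    KoopmanRKHS.summable_crossTerm B (hinv t) _,
    KoopmanRKHS.sigmaInfSq_le B (hinv t) hu⟩
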